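/- Theorem 7.2. Let $n \ge 1$ be an integer and let $\sigma \in S_n$ be a permutation with exactly $k$ cycles, where fixed points are counted as cycles of length one. Then $$|\chi(\sigma)| \le 2^{k-1}\, k!$$ for every irreducible complex character $\chi$ of $S_n$. -/

import Mathlib

/-- The number of cycles of a permutation of a finite set, fixed points included:
`σ.cycleType` is the multiset of the lengths of the cycles of length at least `2`, and each
fixed point contributes one further cycle. -/
def numCycles {α : Type*} [Fintype α] [DecidableEq α] (σ : Equiv.Perm α) : ℕ :=
  Multiset.card σ.cycleType + Fintype.card (Function.fixedPoints σ)

open Finset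

/-! The stronger bound `k!` holds. Let `c_μ(β)` be `frobCoeff`, the coefficient in Frobenius's
formula, and view the entries of `β` as beads on an abacus. Removing a largest part `m` of `μ`
writes `c_μ(β)` as a sum over moves of one bead down by `m`. All moves with nonzero contribution can
be made at once, at a cost of `m` each out of a total `μ.sum ≤ k * m`, so there are at most `k` of
them, and induction gives `|c_μ(β)| ≤ k!` (`abs_frobCoeff_le`).

No classification of the irreducibles is needed. Orthogonality over `β`
(`finsum_frobCoeff_mul_frobCoeff`) gives `n! χ(σ) = ∑ a_β c_σ(β)`, where `n! a_β = ∑ χ(τ) c_τ(β)`.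
The `a_β` are integers because `τ ↦ c_τ(β)` is a signed sum of permutation characters, and `∑ a_β ^
2 = n!` because `χ` has norm one. Since `|a_β| ≤ a_β ^ 2`, the bound on `c` passes to `χ`. -/

namespace FrobeniusCoeff

/-! ### Coefficients of power sums times the Vandermonde determinant. -/

/-- The power sum `∑ i, X i ^ m` as a Laurent polynomial. -/
noncomputable def powerSum (N m : ℕ) : AddMonoidAlgebra ℤ (Fin N → ℤ) :=
  ∑ i, .single (Pi.single i (m : ℤ)) 1

/-- The Vandermonde determinant `∑ w, sign w * ∏ i, X i ^ w i` as a Laurent polynomial. -/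
noncomputable def vandermonde (N : ℕ) : AddMonoidAlgebra ℤ (Fin N → ℤ) :=
  ∑ w : Equiv.Perm (Fin N), .single (fun i => ((w i : ℕ) : ℤ)) (Equiv.Perm.sign w : ℤ)

/-- The coefficient of `X ^ β` in the product of the Vandermonde determinant and the power sums
indexed by the parts of `μ`. -/
noncomputable def frobCoeff (N : ℕ) (μ : Multiset ℕ) (β : Fin N → ℤ) : ℤ :=
  ((μ.map (powerSum N)).prod * vandermonde N).coeff β

variable {N : ℕ}

theorem coeff_single_mul (x β : Fin N → ℤ) (F : AddMonoidAlgebra ℤ (Fin N → ℤ)) :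
    (AddMonoidAlgebra.single x 1 * F).coeff β = F.coeff (β - x) := by
  have := AddMonoidAlgebra.coeff_single_mul_add F (1 : ℤ) x (β - x)
  simpa using this

theorem frobCoeff_cons (m : ℕ) (μ : Multiset ℕ) (β : Fin N → ℤ) :
    frobCoeff N (m ::ₘ μ) β = ∑ i, frobCoeff N μ (β - Pi.single i (m : ℤ)) := by
  simp only [frobCoeff, Multiset.map_cons, Multiset.prod_cons, mul_assoc]
  rw [powerSum, Finset.sum_mul, AddMonoidAlgebra.coeff_sum, Finsupp.finsetSum_apply]
  simp only [coeff_single_mul]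

theorem frobCoeff_zero (β : Fin N → ℤ) :
    frobCoeff N 0 β = ∑ w : Equiv.Perm (Fin N),
      if β = fun i => ((w i : ℕ) : ℤ) then (Equiv.Perm.sign w : ℤ) else 0 := by
  simp [frobCoeff, vandermonde, Finsupp.single_apply, eq_comm]

theorem exists_perm_of_frobCoeff_zero_ne_zero {β : Fin N → ℤ} (h : frobCoeff N 0 β ≠ 0) :
    ∃ w : Equiv.Perm (Fin N), β = fun i => ((w i : ℕ) : ℤ) := by
  by_contra! h'
  exact h (by rw [frobCoeff_zero]; simp [h'])

theorem exists_of_frobCoeff_cons_ne_zero {m : ℕ} {μ : Multiset ℕ} {β : Fin N → ℤ}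
    (h : frobCoeff N (m ::ₘ μ) β ≠ 0) :
    ∃ i, frobCoeff N μ (β - Pi.single i (m : ℤ)) ≠ 0 := by
  rw [frobCoeff_cons] at h
  obtain ⟨i, -, hi⟩ := Finset.exists_ne_zero_of_sum_ne_zero h
  exact ⟨i, hi⟩

theorem nonneg_of_frobCoeff_ne_zero {μ : Multiset ℕ} {β : Fin N → ℤ}
    (h : frobCoeff N μ β ≠ 0) (j : Fin N) : 0 ≤ β j := by
  induction μ using Multiset.induction generalizing β with
  | empty =>
    obtain ⟨w, rfl⟩ := exists_perm_of_frobCoeff_zero_ne_zero h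
    simp
  | cons m μ ih =>
    obtain ⟨i, hi⟩ := exists_of_frobCoeff_cons_ne_zero h
    have := ih hi
    rw [Pi.sub_apply, Pi.single_apply] at this
    split_ifs at this <;> omega

theorem sum_of_frobCoeff_ne_zero {μ : Multiset ℕ} {β : Fin N → ℤ}
    (h : frobCoeff N μ β ≠ 0) : ∑ j, β j = ∑ j : Fin N, ((j : ℕ) : ℤ) + μ.sum := by
  induction μ using Multiset.induction generalizing β with
  | empty =>
    obtain ⟨w, rfl⟩ := exists_perm_of_frobCoeff_zero_ne_zero h
    simpa using Equiv.sum_comp w (fun j : Fin N => ((j : ℕ) : ℤ))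
  | cons m μ ih =>
    obtain ⟨i, hi⟩ := exists_of_frobCoeff_cons_ne_zero h
    have := ih hi
    simp only [Pi.sub_apply, Finset.sum_sub_distrib, Finset.sum_pi_single', Finset.mem_univ,
      if_true] at this
    rw [Multiset.sum_cons, Nat.cast_add]
    linarith

/-- Power sums are symmetric and the Vandermonde determinant is alternating. -/
theorem frobCoeff_comp_perm (μ : Multiset ℕ) (β : Fin N → ℤ) (u : Equiv.Perm (Fin N)) :
    frobCoeff N μ (β ∘ u) = (Equiv.Perm.sign u : ℤ) * frobCoeff N μ β := by
  induction μ using Multiset.induction generalizing β with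
  | empty =>
    rw [frobCoeff_zero, frobCoeff_zero, Finset.mul_sum]
    refine Fintype.sum_equiv (Equiv.mulRight u⁻¹) _ _ fun w => ?_
    have : (β ∘ u = fun i => ((w i : ℕ) : ℤ)) ↔ β = fun i => (((w * u⁻¹) i : ℕ) : ℤ) := by
      constructor
      · intro h
        funext i
        simpa using congrFun h (u⁻¹ i)
      · intro h
        funext i
        simp [h]
    by_cases hβ : β = fun i => (((w * u⁻¹) i : ℕ) : ℤ)
    · rw [if_pos (this.2 hβ)]
      refine Eq.trans ?_ (congrArg (_ * ·) (if_pos hβ).symm)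
      rw [Equiv.coe_mulRight, Equiv.Perm.sign_mul, Equiv.Perm.sign_inv]
      rcases Int.units_eq_one_or (Equiv.Perm.sign u) with h | h <;> simp [h]
    · rw [if_neg fun h => hβ (this.1 h)]
      exact (mul_eq_zero_of_right _ (if_neg hβ)).symm
  | cons m μ ih =>
    rw [frobCoeff_cons, frobCoeff_cons, Finset.mul_sum]
    refine Fintype.sum_equiv u _ _ fun i => ?_
    rw [← ih]
    congr 1
    funext j
    simp [Pi.single_apply]

theorem injective_of_frobCoeff_ne_zero {μ : Multiset ℕ} {β : Fin N → ℤ}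
    (h : frobCoeff N μ β ≠ 0) : Function.Injective β := by
  intro i j hij
  by_contra hne
  have h1 := frobCoeff_comp_perm μ β (Equiv.swap i j)
  have h2 : β ∘ Equiv.swap i j = β := by
    funext x
    simp only [Function.comp_apply, Equiv.swap_apply_def]
    split_ifs <;> simp_all
  rw [h2, Equiv.Perm.sign_swap hne] at h1
  push_cast at h1
  omega

/-- Moves of total length `μ.sum` cannot vacate a low position: a bead leaving `v` would land on `v
+ m`, which is still occupied. -/
theorem exists_eq_of_frobCoeff_ne_zero {μ : Multiset ℕ} {β : Fin N → ℤ}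
    (h : frobCoeff N μ β ≠ 0) {v : ℤ} (hv : 0 ≤ v) (hvN : v + μ.sum < N) : ∃ i, β i = v := by
  induction μ using Multiset.induction generalizing β v with
  | empty =>
    obtain ⟨w, rfl⟩ := exists_perm_of_frobCoeff_zero_ne_zero h
    simp only [Multiset.sum_zero, Nat.cast_zero, add_zero] at hvN
    refine ⟨w⁻¹ ⟨v.toNat, by omega⟩, ?_⟩
    simp [hv]
  | cons m μ ih =>
    rw [Multiset.sum_cons, Nat.cast_add] at hvN
    obtain ⟨i, hi⟩ := exists_of_frobCoeff_cons_ne_zero h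
    obtain ⟨j, hj⟩ := ih hi hv (by omega)
    rw [Pi.sub_apply, Pi.single_apply] at hj
    split_ifs at hj with hji
    · obtain ⟨l, hl⟩ := ih hi (v := v + m) (by omega) (by omega)
      rw [Pi.sub_apply, Pi.single_apply] at hl
      split_ifs at hl with hli
      · exact ⟨j, by subst hji; subst hli; omega⟩
      · have := injective_of_frobCoeff_ne_zero h (a₁ := l) (a₂ := j) (by omega)
        exact absurd (this.trans hji) hli
    · exact ⟨j, by omega⟩

/-! ### The adjoint of multiplication by a power sum. -/

theorem sum_ite_frobCoeff_add_single_of_not_injective (μ : Multiset ℕ) {β : Fin N → ℤ}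
    (hβ : ¬ Function.Injective β) (t : ℤ) (P : ℤ → Prop) [DecidablePred P] :
    (∑ j, if P (β j) then frobCoeff N μ (β + Pi.single j t) else 0) = 0 := by
  simp only [Function.Injective, not_forall] at hβ
  obtain ⟨a, b, hab, hne⟩ := hβ
  set u := Equiv.swap a b with hu
  have h2 : ∀ x, β (u x) = β x := by
    intro x
    rw [hu, Equiv.swap_apply_def]
    split_ifs <;> simp_all
  have key : (∑ j, if P (β j) then frobCoeff N μ (β + Pi.single j t) else 0) =
      -∑ j, if P (β j) then frobCoeff N μ (β + Pi.single j t) else 0 := by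
    rw [← Finset.sum_neg_distrib]
    refine Fintype.sum_equiv u _ _ fun j => ?_
    have h3 : β + Pi.single (u j) t = (β + Pi.single j t) ∘ u := by
      funext x
      have : x = u j ↔ u x = j := by
        constructor
        · rintro rfl
          simp [hu]
        · rintro rfl
          simp [hu]
      simp [h2, Pi.single_apply, this]
    rw [h2, h3, frobCoeff_comp_perm, hu, Equiv.Perm.sign_swap hne]
    split_ifs <;> simp
  omega

/-- This is the commutator term in `sum_frobCoeff_add_single`. If `m = l`, the positions `0, ..., l
- 1` each hold one bead, giving `l` equal terms. Otherwise a nonzero term needs a second bead at the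
vacated position `β j`. -/
theorem sum_ite_lt_frobCoeff_add_single {μ : Multiset ℕ} {l : ℕ} (hl : l + μ.sum ≤ N) (m : ℕ)
    {β : Fin N → ℤ} (hβ : ∀ i, 0 ≤ β i) :
    (∑ j, if β j < l then frobCoeff N μ (β + Pi.single j ((m : ℤ) - l)) else 0) =
      if m = l then l * frobCoeff N μ β else 0 := by
  split_ifs with hml
  · subst hml
    simp only [sub_self, Pi.single_zero, add_zero]
    by_cases hc : frobCoeff N μ β = 0
    · simp [hc]
    rw [← Finset.sum_filter, Finset.sum_const, nsmul_eq_mul]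
    congr 2
    rw [← Finset.card_image_of_injective _ (injective_of_frobCoeff_ne_zero hc)]
    have : (univ.filter fun j => β j < m).image β = Finset.Ico (0 : ℤ) m := by
      ext v
      simp only [mem_image, mem_filter, mem_univ, true_and, mem_Ico]
      constructor
      · rintro ⟨j, hj, rfl⟩
        exact ⟨hβ j, hj⟩
      · rintro ⟨h0, h1⟩
        obtain ⟨i, hi⟩ := exists_eq_of_frobCoeff_ne_zero hc h0 (by omega)
        exact ⟨i, by omega, hi⟩
    rw [this, Int.card_Ico]
    simp
  · by_cases hinj : Function.Injective β
    · refine Finset.sum_eq_zero fun j _ => ?_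
      split_ifs with hj
      · by_contra hc
        obtain ⟨i, hi⟩ := exists_eq_of_frobCoeff_ne_zero hc (hβ j) (by omega)
        rw [Pi.add_apply, Pi.single_apply] at hi
        split_ifs at hi with hij
        · subst hij
          omega
        · exact hij (hinj (by omega))
      · rfl
    · exact sum_ite_frobCoeff_add_single_of_not_injective μ hinj _ (fun x => x < l)

/-- Subtracting rim hooks: the operator adjoint to multiplication by a power sum acts on the
coefficients as a derivation in the power sums. -/
theorem sum_frobCoeff_add_single {μ : Multiset ℕ} (hμ : μ.sum ≤ N) {m : ℕ} (hm : 0 < m)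
    {β : Fin N → ℤ} (hβ : ∀ i, 0 ≤ β i) :
    ∑ i, frobCoeff N μ (β + Pi.single i (m : ℤ)) =
      m * μ.count m * frobCoeff N (μ.erase m) β := by
  induction μ using Multiset.induction generalizing β with
  | empty =>
    simp only [Multiset.count_zero, Nat.cast_zero, mul_zero, zero_mul]
    by_cases hinj : Function.Injective β
    · refine Finset.sum_eq_zero fun i _ => ?_
      by_contra hc
      have hi : (β + Pi.single i (m : ℤ) : Fin N → ℤ) i < N := by
        obtain ⟨w, hw⟩ := exists_perm_of_frobCoeff_zero_ne_zero hc
        rw [hw]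
        exact Nat.cast_lt.mpr (w i).2
      simp only [Pi.add_apply, Pi.single_eq_same] at hi
      obtain ⟨j, hj⟩ := exists_eq_of_frobCoeff_ne_zero hc (hβ i) (by simp; omega)
      rw [Pi.add_apply, Pi.single_apply] at hj
      split_ifs at hj with hij
      · subst hij
        omega
      · exact hij (hinj (by omega))
    · simpa using sum_ite_frobCoeff_add_single_of_not_injective 0 hinj m (fun _ => True)
  | cons l μ ih =>
    rw [Multiset.sum_cons] at hμ
    -- When `β j < l`, the vector `β - Pi.single j l` has a negative entry, so induction does not
    -- apply; only `i = j` can repair that entry.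
    have hterm : ∀ j, ∑ i, frobCoeff N μ (β + Pi.single i (m : ℤ) - Pi.single j (l : ℤ)) =
        m * μ.count m * frobCoeff N (μ.erase m) (β - Pi.single j (l : ℤ)) +
        if β j < l then frobCoeff N μ (β + Pi.single j ((m : ℤ) - l)) else 0 := by
      intro j
      simp only [add_sub_right_comm]
      split_ifs with hj
      · have h0 : frobCoeff N (μ.erase m) (β - Pi.single j (l : ℤ)) = 0 := by
          by_contra hc
          have := nonneg_of_frobCoeff_ne_zero hc j
          simp only [Pi.sub_apply, Pi.single_eq_same] at this
          omega
        rw [h0, mul_zero, zero_add, Finset.sum_eq_single j]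
        · rw [Pi.single_sub]
          congr 1
          abel
        · intro i _ hij
          by_contra hc
          have := nonneg_of_frobCoeff_ne_zero hc j
          simp only [Pi.sub_apply, Pi.add_apply, Pi.single_eq_same, Pi.single_apply,
            if_neg hij.symm] at this
          omega
        · simp
      · rw [add_zero]
        refine ih (by omega) fun i => ?_
        rw [Pi.sub_apply, Pi.single_apply]
        have := hβ i
        split_ifs with hij
        · subst hij
          omega
        · omega
    simp only [frobCoeff_cons]
    rw [Finset.sum_comm]
    simp only [hterm]
    rw [Finset.sum_add_distrib, ← Finset.mul_sum, ← frobCoeff_cons,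
      sum_ite_lt_frobCoeff_add_single hμ m hβ]
    split_ifs with hml
    · subst hml
      rw [Multiset.erase_cons_head, Multiset.count_cons_self]
      by_cases hmem : m ∈ μ
      · rw [Multiset.cons_erase hmem]
        push_cast
        ring
      · rw [Multiset.count_eq_zero_of_notMem hmem]
        simp
    · rw [Multiset.erase_cons_tail _ (Ne.symm hml), Multiset.count_cons_of_ne hml, add_zero]

/-! ### Orthogonality of the coefficients. -/

/-- The order of the centralizer of a permutation with cycle lengths `μ`. -/
def centralizerOrder (μ : Multiset ℕ) : ℕ := μ.prod * ∏ i ∈ μ.toFinset, (μ.count i).factorial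

theorem centralizerOrder_cons (m : ℕ) (μ : Multiset ℕ) :
    centralizerOrder (m ::ₘ μ) = m * (μ.count m + 1) * centralizerOrder μ := by
  have h1 : ∀ ν : Multiset ℕ, ∀ s : Finset ℕ, ν.toFinset ⊆ s →
      ∏ i ∈ ν.toFinset, (ν.count i).factorial = ∏ i ∈ s, (ν.count i).factorial := by
    intro ν s hs
    refine Finset.prod_subset hs fun x _ hx => ?_
    rw [Multiset.count_eq_zero_of_notMem (by simpa using hx), Nat.factorial_zero]
  have hm : m ∈ insert m μ.toFinset := Finset.mem_insert_self _ _
  rw [centralizerOrder, centralizerOrder, h1 (m ::ₘ μ) (insert m μ.toFinset) (by simp),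
    h1 μ (insert m μ.toFinset) (by simp), ← Finset.mul_prod_erase _ _ hm,
    ← Finset.mul_prod_erase _ (fun i => (μ.count i).factorial) hm, Multiset.prod_cons,
    Multiset.count_cons_self, Nat.factorial_succ]
  have : ∏ i ∈ (insert m μ.toFinset).erase m, ((m ::ₘ μ).count i).factorial =
      ∏ i ∈ (insert m μ.toFinset).erase m, (μ.count i).factorial := by
    refine Finset.prod_congr rfl fun x hx => ?_
    rw [Multiset.count_cons_of_ne (Finset.ne_of_mem_erase hx)]
  rw [this]
  ring

theorem finite_support_frobCoeff (N : ℕ) (μ : Multiset ℕ) :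
    (Function.support (frobCoeff N μ)).Finite :=
  Finsupp.hasFiniteSupport _

theorem finsum_frobCoeff_cons_mul (m : ℕ) (μ : Multiset ℕ) (g : (Fin N → ℤ) → ℤ) :
    ∑ᶠ β, frobCoeff N (m ::ₘ μ) β * g β =
      ∑ᶠ β, frobCoeff N μ β * ∑ i, g (β + Pi.single i (m : ℤ)) := by
  have hfin : ∀ i : Fin N, (Function.support fun β : Fin N → ℤ =>
      frobCoeff N μ β * g (β + Pi.single i (m : ℤ))).Finite := fun i =>
    (finite_support_frobCoeff N μ).subset fun β hβ h => hβ (by simp [h])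
  simp only [frobCoeff_cons, Finset.sum_mul, Finset.mul_sum]
  rw [finsum_sum_comm, finsum_sum_comm]
  · refine Finset.sum_congr rfl fun i _ => ?_
    rw [← finsum_comp_equiv (Equiv.addRight (Pi.single i (m : ℤ) : Fin N → ℤ))]
    simp
  · exact fun i _ => hfin i
  · intro i _
    refine ((hfin i).preimage
      (f := fun β => β - Pi.single i (m : ℤ)) (sub_left_injective.injOn)).subset fun β hβ => ?_
    simpa using hβ

theorem finsum_frobCoeff_zero_mul_self :
    ∑ᶠ β, frobCoeff N 0 β * frobCoeff N 0 β = N.factorial := by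
  have h0 : ∀ w : Equiv.Perm (Fin N), frobCoeff N 0 (fun i => ((w i : ℕ) : ℤ)) =
      Equiv.Perm.sign w := by
    intro w
    rw [frobCoeff_zero, Finset.sum_eq_single w]
    · simp
    · intro u _ hu
      rw [if_neg]
      intro h
      refine hu (Equiv.ext fun i => Fin.ext ?_)
      exact_mod_cast (congrFun h i).symm
    · simp
  have h1 : ∀ β : Fin N → ℤ, frobCoeff N 0 β * frobCoeff N 0 β =
      ∑ w : Equiv.Perm (Fin N), if β = fun i => ((w i : ℕ) : ℤ) then 1 else 0 := by
    intro β
    nth_rewrite 1 [frobCoeff_zero]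
    rw [Finset.sum_mul]
    refine Finset.sum_congr rfl fun w _ => ?_
    split_ifs with h
    · rw [h, h0]
      rw [← Units.val_mul, Int.units_mul_self, Units.val_one]
    · simp
  simp only [h1]
  rw [finsum_sum_comm]
  · have : ∀ w : Equiv.Perm (Fin N),
        (∑ᶠ β : Fin N → ℤ, if β = fun i => ((w i : ℕ) : ℤ) then (1 : ℤ) else 0) = 1 := by
      intro w
      rw [finsum_eq_single _ (fun i => ((w i : ℕ) : ℤ)) (fun β hβ => if_neg hβ), if_pos rfl]
    simp [this, Fintype.card_perm]
  · intro w _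
    exact (Set.finite_singleton (fun i => ((w i : ℕ) : ℤ))).subset fun β hβ => by
      by_contra h
      exact hβ (if_neg h)

/-- Adjointness strips a part `m` from `μ` and from `ν` together, at the cost of a factor `m *
ν.count m`, which is the recursion of `centralizerOrder`. The factor `N!` counts the orderings of
the bead positions. -/
theorem finsum_frobCoeff_mul_frobCoeff {μ ν : Multiset ℕ} (hμ : ∀ m ∈ μ, 0 < m)
    (hν : ∀ m ∈ ν, 0 < m) (hνN : ν.sum ≤ N) :
    ∑ᶠ β, frobCoeff N μ β * frobCoeff N ν β =
      if μ = ν then (N.factorial * centralizerOrder μ : ℤ) else 0 := by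
  have adj : ∀ {m : ℕ} {μ ν : Multiset ℕ}, 0 < m → ν.sum ≤ N →
      ∑ᶠ β, frobCoeff N (m ::ₘ μ) β * frobCoeff N ν β =
        m * ν.count m * ∑ᶠ β, frobCoeff N μ β * frobCoeff N (ν.erase m) β := by
    intro m μ ν hm hν
    rw [finsum_frobCoeff_cons_mul, mul_finsum]
    refine finsum_congr fun β => ?_
    by_cases hc : frobCoeff N μ β = 0
    · simp [hc]
    · rw [sum_frobCoeff_add_single hν hm (nonneg_of_frobCoeff_ne_zero hc)]
      ring
  induction μ using Multiset.induction generalizing ν with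
  | empty =>
    split_ifs with h
    · subst h
      rw [finsum_frobCoeff_zero_mul_self]
      simp [centralizerOrder]
    · obtain ⟨l, hl⟩ := Multiset.exists_mem_of_ne_zero (Ne.symm h)
      obtain ⟨ν, rfl⟩ := Multiset.exists_cons_of_mem hl
      -- With the roles exchanged, a part of `ν` is stripped from the empty multiset, where its
      -- count is zero.
      simp only [mul_comm (frobCoeff N 0 _)]
      rw [adj (hν l hl) (by simp)]
      simp
  | cons m μ ih =>
    rw [adj (hμ m (Multiset.mem_cons_self _ _)) hνN]
    by_cases hm : m ∈ ν
    · obtain ⟨ν, rfl⟩ := Multiset.exists_cons_of_mem hm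
      rw [Multiset.sum_cons] at hνN
      rw [Multiset.erase_cons_head, ih (fun x hx => hμ x (Multiset.mem_cons_of_mem hx))
        (fun x hx => hν x (Multiset.mem_cons_of_mem hx)) (by omega), Multiset.count_cons_self]
      simp only [Multiset.cons_inj_right]
      split_ifs with h
      · subst h
        rw [centralizerOrder_cons]
        push_cast
        ring
      · simp
    · rw [Multiset.count_eq_zero_of_notMem hm, if_neg]
      · simp
      · rintro rfl
        exact hm (Multiset.mem_cons_self _ _)

/-! ### The factorial bound on the coefficients. -/

theorem sum_fin_le_sum_of_injective {β : Fin N → ℤ} (h0 : ∀ i, 0 ≤ β i)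
    (hβ : Function.Injective β) : ∑ j : Fin N, ((j : ℕ) : ℤ) ≤ ∑ j, β j := by
  have := Finset.sum_range_le_sum (s := univ.image β) (c := 0) (by simpa using h0)
  rw [Finset.card_image_of_injective _ hβ, Finset.sum_image hβ.injOn] at this
  simpa [Fin.sum_univ_eq_sum_range (fun i => (i : ℤ))] using this

/-- Making all contributing moves simultaneously gives `γ`, whose entries are still distinct and
nonnegative, so their sum is at least `0 + 1 + ... + (N - 1)`. -/
theorem card_filter_frobCoeff_sub_single_ne_zero_le {m : ℕ} {μ : Multiset ℕ} {β : Fin N → ℤ}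
    (hβ : frobCoeff N (m ::ₘ μ) β ≠ 0) :
    m * #{i | frobCoeff N μ (β - Pi.single i (m : ℤ)) ≠ 0} ≤ m + μ.sum := by
  have hinj := injective_of_frobCoeff_ne_zero hβ
  set γ : Fin N → ℤ := fun i =>
    if frobCoeff N μ (β - Pi.single i (m : ℤ)) ≠ 0 then β i - m else β i with hγ
  have hmove : ∀ i j, frobCoeff N μ (β - Pi.single i (m : ℤ)) ≠ 0 → i ≠ j → β i - m ≠ β j := by
    intro i j hi hij h
    refine hij (injective_of_frobCoeff_ne_zero hi ?_)
    simpa [Pi.single_apply, hij.symm] using h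
  have hγinj : Function.Injective γ := by
    intro i j hij
    by_contra hne
    simp only [hγ] at hij
    split_ifs at hij with h1 h2 h2
    · exact hne (hinj (by omega))
    · exact hmove i j h1 hne hij
    · exact hmove j i h2 (Ne.symm hne) hij.symm
    · exact hne (hinj hij)
  have hγ0 : ∀ i, 0 ≤ γ i := by
    intro i
    simp only [hγ]
    split_ifs with h
    · simpa using nonneg_of_frobCoeff_ne_zero h i
    · exact nonneg_of_frobCoeff_ne_zero hβ i
  have hsum := sum_fin_le_sum_of_injective hγ0 hγinj
  have hγsum : ∑ j, γ j =
      ∑ j, β j - m * #{i | frobCoeff N μ (β - Pi.single i (m : ℤ)) ≠ 0} := by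
    have : ∀ j, γ j = β j -
        if frobCoeff N μ (β - Pi.single j (m : ℤ)) ≠ 0 then (m : ℤ) else 0 := by
      intro j
      simp only [hγ]
      split_ifs <;> simp
    simp only [this]
    rw [Finset.sum_sub_distrib, ← Finset.sum_filter, Finset.sum_const, nsmul_eq_mul, mul_comm]
  rw [hγsum, sum_of_frobCoeff_ne_zero hβ, Multiset.sum_cons] at hsum
  generalize μ.sum = s at hsum ⊢
  zify
  push_cast at hsum
  linarith

theorem abs_frobCoeff_le {μ : Multiset ℕ} (hμ : ∀ m ∈ μ, 0 < m) (β : Fin N → ℤ) :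
    |frobCoeff N μ β| ≤ (Multiset.card μ).factorial := by
  induction hk : Multiset.card μ generalizing μ β with
  | zero =>
    obtain rfl := Multiset.card_eq_zero.mp hk
    by_cases h : frobCoeff N 0 β = 0
    · simp [h]
    · obtain ⟨w, rfl⟩ := exists_perm_of_frobCoeff_zero_ne_zero h
      have h1 : frobCoeff N 0 ((fun i : Fin N => ((i : ℕ) : ℤ)) ∘ w) = _ :=
        frobCoeff_comp_perm 0 _ w
      have h2 : frobCoeff N 0 (fun i : Fin N => ((i : ℕ) : ℤ)) = 1 := by
        rw [frobCoeff_zero, Finset.sum_eq_single 1]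
        · simp
        · intro u _ hu
          rw [if_neg]
          intro h
          refine hu (Equiv.ext fun i => Fin.ext ?_)
          exact_mod_cast (congrFun h i).symm
        · simp
      rw [h2, mul_one] at h1
      rw [show (fun i => ((w i : ℕ) : ℤ)) = (fun i : Fin N => ((i : ℕ) : ℤ)) ∘ w from rfl, h1]
      rcases Int.units_eq_one_or (Equiv.Perm.sign w) with h | h <;> simp [h]
  | succ k ih =>
    by_cases hc : frobCoeff N μ β = 0
    · rw [hc, abs_zero]
      positivity
    have hne : μ.toFinset.Nonempty := by
      rw [Multiset.toFinset_nonempty]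
      rintro rfl
      simp at hk
    -- Taking the largest part makes the total size at most `(k + 1) * m`, hence at most `k + 1`
    -- contributing moves.
    obtain ⟨m, hm, hmax⟩ := μ.toFinset.exists_max_image id hne
    rw [Multiset.mem_toFinset] at hm
    obtain ⟨ν, rfl⟩ := Multiset.exists_cons_of_mem hm
    rw [Multiset.card_cons, Nat.add_right_cancel_iff] at hk
    have hmpos := hμ m hm
    have hcard : #{i | frobCoeff N ν (β - Pi.single i (m : ℤ)) ≠ 0} ≤ k + 1 := by
      have h1 := card_filter_frobCoeff_sub_single_ne_zero_le hc
      have h2 : ν.sum ≤ k * m := by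
        have := Multiset.sum_le_card_nsmul ν m fun x hx => hmax x (by simp [hx])
        rwa [hk, smul_eq_mul] at this
      refine Nat.le_of_mul_le_mul_left (h1.trans ?_) hmpos
      linarith
    rw [frobCoeff_cons, ← Finset.sum_filter_ne_zero]
    refine (Finset.abs_sum_le_sum_abs _ _).trans ((Finset.sum_le_card_nsmul _ _ _ fun i _ =>
      ih (fun x hx => hμ x (Multiset.mem_cons_of_mem hx)) _ hk).trans ?_)
    rw [nsmul_eq_mul, Nat.factorial_succ]
    exact_mod_cast Nat.mul_le_mul_right _ hcard

end FrobeniusCoeff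

/-! ### Cycles of a permutation and the words it fixes. -/

namespace FrobeniusCoeff

section Permutations

variable {α : Type*} [Fintype α] [DecidableEq α]

theorem card_parts_partition (σ : Equiv.Perm α) :
    Multiset.card σ.partition.parts = numCycles σ := by
  rw [Equiv.Perm.parts_partition, numCycles, Multiset.card_add, Multiset.card_replicate,
    Equiv.Perm.card_fixedPoints, Equiv.Perm.sum_cycleType]

theorem centralizerOrder_add_replicate_one {μ : Multiset ℕ} (hμ : 1 ∉ μ) (c : ℕ) :
    centralizerOrder (μ + Multiset.replicate c 1) = c.factorial * centralizerOrder μ := by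
  induction c with
  | zero => simp
  | succ c ih =>
    rw [Multiset.replicate_succ, Multiset.add_cons, centralizerOrder_cons, ih, Multiset.count_add,
      Multiset.count_eq_zero_of_notMem hμ, Multiset.count_replicate_self, Nat.factorial_succ]
    ring

theorem card_isConj_mul_centralizerOrder (σ : Equiv.Perm α) :
    Nat.card {τ : Equiv.Perm α | IsConj σ τ} * centralizerOrder σ.partition.parts =
      (Fintype.card α).factorial := by
  have h1 : 1 ∉ σ.cycleType := fun h => by
    have := Equiv.Perm.two_le_of_mem_cycleType h
    omega
  rw [← Equiv.Perm.card_isConj_mul_eq σ, Equiv.Perm.parts_partition,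
    centralizerOrder_add_replicate_one h1, centralizerOrder, Equiv.Perm.sum_cycleType, mul_assoc]

/-- The orbits of a permutation: its nontrivial cycles and its fixed points. -/
abbrev CycleIndex (σ : Equiv.Perm α) : Type _ :=
  {c // c ∈ σ.cycleFactorsFinset} ⊕ {x // x ∉ σ.support}

/-- The orbit of a point. -/
def cycleIndex (σ : Equiv.Perm α) (x : α) : CycleIndex σ :=
  if h : x ∈ σ.support then
    .inl ⟨σ.cycleOf x, Equiv.Perm.cycleOf_mem_cycleFactorsFinset_iff.2 h⟩
  else .inr ⟨x, h⟩

/-- The number of points of an orbit. -/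
def cycleSize (σ : Equiv.Perm α) : CycleIndex σ → ℕ :=
  Sum.elim (fun c => #c.1.support) fun _ => 1

theorem cycleIndex_eq_inl_iff (σ : Equiv.Perm α) (x : α) (c : {c // c ∈ σ.cycleFactorsFinset}) :
    cycleIndex σ x = .inl c ↔ x ∈ c.1.support := by
  constructor
  · intro h
    rw [cycleIndex] at h
    split_ifs at h with hx
    rw [← Sum.inl.inj h]
    exact Equiv.Perm.mem_support_cycleOf_iff.2 ⟨.refl _ _, hx⟩
  · intro h
    have hx := Equiv.Perm.mem_cycleFactorsFinset_support_le c.2 h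
    rw [cycleIndex, dif_pos hx]
    congr 1
    exact Subtype.ext (Equiv.Perm.cycle_is_cycleOf h c.2).symm

theorem cycleIndex_eq_inr_iff (σ : Equiv.Perm α) (x : α) (y : {x // x ∉ σ.support}) :
    cycleIndex σ x = .inr y ↔ x = y := by
  rw [cycleIndex]
  split_ifs with h
  · simp only [false_iff]
    rintro rfl
    exact y.2 h
  · simp [Subtype.ext_iff]

theorem cycleIndex_eq_iff (σ : Equiv.Perm α) (x y : α) :
    cycleIndex σ x = cycleIndex σ y ↔ σ.SameCycle x y := by
  by_cases hy : y ∈ σ.support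
  · rw [show cycleIndex σ y = .inl ⟨_, Equiv.Perm.cycleOf_mem_cycleFactorsFinset_iff.2 hy⟩ from
      dif_pos hy, cycleIndex_eq_inl_iff, Equiv.Perm.mem_support_cycleOf_iff, and_iff_left hy,
      Equiv.Perm.sameCycle_comm]
  · rw [show cycleIndex σ y = .inr ⟨y, hy⟩ from dif_neg hy, cycleIndex_eq_inr_iff]
    constructor
    · rintro rfl
      exact .refl _ _
    · intro h
      exact (h.symm.eq_of_left (Equiv.Perm.notMem_support.1 hy)).symm

theorem cycleIndex_surjective (σ : Equiv.Perm α) : Function.Surjective (cycleIndex σ) := by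
  rintro (c | y)
  · obtain ⟨x, hx⟩ := ((Equiv.Perm.mem_cycleFactorsFinset_iff.1 c.2).1).nonempty_support
    exact ⟨x, (cycleIndex_eq_inl_iff σ x c).2 hx⟩
  · exact ⟨y, (cycleIndex_eq_inr_iff σ y y).2 rfl⟩

theorem card_filter_cycleIndex_eq (σ : Equiv.Perm α) (q : CycleIndex σ) :
    #{x | cycleIndex σ x = q} = cycleSize σ q := by
  rcases q with c | y
  · simp only [cycleIndex_eq_inl_iff, cycleSize, Sum.elim_inl]
    congr 1
    ext
    simp
  · simp only [cycleIndex_eq_inr_iff, cycleSize, Sum.elim_inr]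
    simp [Finset.filter_eq']

theorem comp_eq_self_iff_exists_comp_cycleIndex {B : Type*} (σ : Equiv.Perm α) (f : α → B) :
    f ∘ σ = f ↔ ∃ g, g ∘ cycleIndex σ = f := by
  constructor
  · intro h
    have hz : ∀ (i : ℤ) x, f ((σ ^ i) x) = f x := by
      intro i
      induction i with
      | zero => simp
      | succ i ih => intro x; rw [zpow_add_one, Equiv.Perm.mul_apply, ih]; exact congrFun h x
      | pred i ih =>
        intro x
        rw [zpow_sub_one, Equiv.Perm.mul_apply, ih, ← congrFun h (σ⁻¹ x)]
        simp
    refine ⟨f ∘ Function.surjInv (cycleIndex_surjective σ), ?_⟩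
    funext x
    obtain ⟨i, hi⟩ := (cycleIndex_eq_iff σ _ _).1
      (Function.surjInv_eq (cycleIndex_surjective σ) (cycleIndex σ x))
    have := hz i (Function.surjInv (cycleIndex_surjective σ) (cycleIndex σ x))
    rw [hi] at this
    exact this.symm
  · rintro ⟨g, rfl⟩
    funext x
    exact congrArg g ((cycleIndex_eq_iff σ _ _).2
      (Equiv.Perm.sameCycle_apply_left.2 (.refl _ _)))

theorem map_partition_prod {M : Type*} [CommMonoid M] (σ : Equiv.Perm α) (p : ℕ → M) :
    (σ.partition.parts.map p).prod = ∏ q : CycleIndex σ, p (cycleSize σ q) := by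
  rw [Equiv.Perm.parts_partition, Multiset.map_add, Multiset.prod_add, Multiset.map_replicate,
    Multiset.prod_replicate, Fintype.prod_sum_type]
  congr 1
  · rw [Equiv.Perm.cycleType_def, Multiset.map_map]
    exact (Finset.prod_coe_sort σ.cycleFactorsFinset fun c => p #c.support).symm
  · simp only [cycleSize, Sum.elim_inr, prod_const]
    congr 1
    rw [card_univ, Fintype.card_subtype, ← Finset.card_compl]
    congr 1
    ext
    simp

end Permutations

variable {N n : ℕ}

/-- The content of a word: the vector counting the occurrences of each letter. -/
def content (f : Fin n → Fin N) : Fin N → ℤ := ∑ x, Pi.single (f x) 1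

theorem content_comp_perm (f : Fin n → Fin N) (τ : Equiv.Perm (Fin n)) :
    content (f ∘ τ) = content f :=
  Equiv.sum_comp τ fun x => (Pi.single (f x) 1 : Fin N → ℤ)

/-- A word fixed by `σ` is a choice of one letter per cycle, and expanding the product makes the
same choices. -/
theorem prod_powerSum_partition (σ : Equiv.Perm (Fin n)) :
    (σ.partition.parts.map (powerSum N)).prod =
      ∑ f : Fin n → Fin N with f ∘ σ = f, AddMonoidAlgebra.single (content f) 1 := by
  rw [map_partition_prod]
  simp only [powerSum]
  rw [Finset.prod_univ_sum, Fintype.piFinset_univ]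
  refine Finset.sum_nbij (fun g => g ∘ cycleIndex σ) ?_ ?_ ?_ ?_
  · intro g _
    simp only [mem_filter, mem_univ, true_and]
    exact (comp_eq_self_iff_exists_comp_cycleIndex σ _).2 ⟨g, rfl⟩
  · intro g _ g' _ h
    exact (cycleIndex_surjective σ).injective_comp_right h
  · intro f hf
    obtain ⟨g, hg⟩ := (comp_eq_self_iff_exists_comp_cycleIndex σ f).1 (by simpa using hf)
    exact ⟨g, by simp, hg⟩
  · intro g _
    rw [AddMonoidAlgebra.prod_single, Finset.prod_const_one]
    congr 1
    rw [content]
    simp only [Function.comp_apply]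
    rw [Finset.sum_comp (fun q => (Pi.single (g q) 1 : Fin N → ℤ)) (cycleIndex σ),
      Finset.image_univ_of_surjective (cycleIndex_surjective σ)]
    refine Finset.sum_congr rfl fun q _ => ?_
    rw [card_filter_cycleIndex_eq, ← Pi.single_smul]
    simp

theorem frobCoeff_partition (σ : Equiv.Perm (Fin n)) (β : Fin N → ℤ) :
    frobCoeff N σ.partition.parts β = ∑ w : Equiv.Perm (Fin N), (Equiv.Perm.sign w : ℤ) *
      #{f : Fin n → Fin N | f ∘ σ = f ∧ content f = β - fun i => ((w i : ℕ) : ℤ)} := by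
  rw [frobCoeff, prod_powerSum_partition, Finset.sum_mul, AddMonoidAlgebra.coeff_sum,
    Finsupp.finsetSum_apply]
  have h0 : ∀ γ : Fin N → ℤ, (vandermonde N).coeff γ = ∑ w : Equiv.Perm (Fin N),
      if γ = fun i => ((w i : ℕ) : ℤ) then (Equiv.Perm.sign w : ℤ) else 0 := by
    intro γ
    rw [← frobCoeff_zero]
    simp [frobCoeff]
  simp only [coeff_single_mul, h0]
  rw [Finset.sum_comm]
  refine Finset.sum_congr rfl fun w _ => ?_
  rw [← Finset.sum_filter, Finset.sum_const, nsmul_eq_mul, mul_comm, Finset.filter_filter]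
  congr 3
  ext f
  simp only [mem_filter, mem_univ, true_and, and_congr_right_iff]
  intro _
  constructor
  · intro h
    rw [← h]
    abel
  · intro h
    rw [h]
    abel

end FrobeniusCoeff

/-! ### Characters and their expansion in the coefficients. -/

namespace FrobeniusCoeff

/-- The permutation representation attached to an action of `G` on `X`. -/
noncomputable def permRep {G X : Type*} [Group G] (φ : G →* Equiv.Perm X) :
    Representation ℂ G (X → ℂ) where
  toFun g := LinearMap.funLeft ℂ ℂ (φ g⁻¹)
  map_one' := by
    ext
    simp [LinearMap.funLeft_apply]
  map_mul' g h := by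
    ext
    simp [LinearMap.funLeft_apply]

theorem character_permRep {G X : Type*} [Group G] [Fintype X] [DecidableEq X]
    (φ : G →* Equiv.Perm X) (g : G) :
    (permRep φ).character g = #{x | φ g x = x} := by
  rw [Representation.character, LinearMap.trace_eq_matrix_trace ℂ (Pi.basisFun ℂ X)]
  simp only [Matrix.trace, Matrix.diag_apply, LinearMap.toMatrix_apply, Pi.basisFun_apply,
    Pi.basisFun_repr]
  rw [← Finset.sum_boole]
  refine Finset.sum_congr rfl fun x _ => ?_
  have : (permRep φ g) (Pi.single x 1) x = (Pi.single x 1 : X → ℂ) (φ g⁻¹ x) := rfl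
  rw [this, Pi.single_apply, map_inv]
  exact if_congr (Equiv.Perm.inv_eq_iff_eq.trans eq_comm) rfl rfl

/-- The witness is the dimension of the invariants of `ρ` tensored with the permutation
representation. -/
theorem exists_sum_character_mul_card_fixed {G X V : Type*} [Group G] [Fintype G] [Fintype X]
    [DecidableEq X] [AddCommGroup V] [Module ℂ V] [FiniteDimensional ℂ V]
    (ρ : Representation ℂ G V) (φ : G →* Equiv.Perm X) :
    ∃ d : ℕ, ∑ g, ρ.character g * (#{x | φ g x = x} : ℂ) = Nat.card G * d := by
  have hne : (Nat.card G : ℂ) ≠ 0 := Nat.cast_ne_zero.mpr Nat.card_pos.ne'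
  let : Invertible (Nat.card G : ℂ) := invertibleOfNonzero hne
  have h := Representation.card_inv_mul_sum_char_eq_finrank (ρ.tprod (permRep φ))
  rw [Representation.char_tensor, inv_mul_eq_iff_eq_mul₀ hne] at h
  simp only [Pi.mul_apply, character_permRep] at h
  exact ⟨_, h⟩

variable {N n : ℕ} {V : Type*} [AddCommGroup V] [Module ℂ V]
  (ρ : Representation ℂ (Equiv.Perm (Fin n)) V)

theorem exists_sum_character_mul_card_words [FiniteDimensional ℂ V] (γ : Fin N → ℤ) :
    ∃ d : ℕ, ∑ τ, ρ.character τ *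
      (#{f : Fin n → Fin N | f ∘ τ = f ∧ content f = γ} : ℂ) = n.factorial * d := by
  let A : MulAction (Equiv.Perm (Fin n)) {f : Fin n → Fin N // content f = γ} :=
    { smul := fun τ f => ⟨f.1 ∘ (τ⁻¹ : Equiv.Perm (Fin n)), by rw [content_comp_perm, f.2]⟩
      one_smul := fun f => rfl
      mul_smul := fun τ υ f => Subtype.ext (by
        funext x
        change f.1 ((τ * υ)⁻¹ x) = f.1 (υ⁻¹ (τ⁻¹ x))
        rw [mul_inv_rev, Equiv.Perm.mul_apply]) }
  obtain ⟨d, hd⟩ := exists_sum_character_mul_card_fixed ρ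
    (MulAction.toPermHom (Equiv.Perm (Fin n)) {f : Fin n → Fin N // content f = γ})
  refine ⟨d, ?_⟩
  rw [Nat.card_perm, Nat.card_fin] at hd
  rw [← hd]
  refine Finset.sum_congr rfl fun τ _ => ?_
  congr 2
  symm
  refine Finset.card_bij (fun f _ => f.1) ?_ (fun f _ g _ h => Subtype.ext h) ?_
  · intro f hf
    simp only [mem_filter, mem_univ, true_and] at hf ⊢
    refine ⟨?_, f.2⟩
    have h1 : f.1 ∘ (τ⁻¹ : Equiv.Perm (Fin n)) = f.1 := congrArg Subtype.val hf
    funext x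
    simpa using (congrFun h1 (τ x)).symm
  · intro f hf
    simp only [mem_filter, mem_univ, true_and] at hf
    refine ⟨⟨f, hf.2⟩, ?_, rfl⟩
    simp only [mem_filter, mem_univ, true_and]
    refine Subtype.ext (?_ : f ∘ (τ⁻¹ : Equiv.Perm (Fin n)) = f)
    funext x
    simpa using (congrFun hf.1 (τ⁻¹ x)).symm

theorem exists_sum_character_mul_frobCoeff [FiniteDimensional ℂ V] (β : Fin N → ℤ) :
    ∃ d : ℤ, ∑ τ : Equiv.Perm (Fin n), ρ.character τ *
      (frobCoeff N τ.partition.parts β : ℂ) = n.factorial * d := by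
  choose d hd using fun γ : Fin N → ℤ => exists_sum_character_mul_card_words (N := N) ρ γ
  refine ⟨∑ w : Equiv.Perm (Fin N), (Equiv.Perm.sign w : ℤ) *
    d (β - fun i => ((w i : ℕ) : ℤ)), ?_⟩
  simp only [frobCoeff_partition]
  push_cast
  simp only [Finset.mul_sum]
  rw [Finset.sum_comm]
  refine Finset.sum_congr rfl fun w _ => ?_
  rw [mul_left_comm, ← hd, Finset.mul_sum]
  exact Finset.sum_congr rfl fun τ _ => mul_left_comm _ _ _

/-- The second orthogonality relation for the Frobenius characters. -/
theorem exists_finset_sum_frobCoeff_mul_frobCoeff (n : ℕ) :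
    ∃ S : Finset (Fin n → ℤ), ∀ σ τ : Equiv.Perm (Fin n),
      ∑ β ∈ S, frobCoeff n σ.partition.parts β * frobCoeff n τ.partition.parts β =
        if IsConj σ τ then (n.factorial * centralizerOrder σ.partition.parts : ℤ) else 0 := by
  classical
  -- The union of all supports is finite and serves every pair `σ`, `τ` at once.
  refine ⟨univ.biUnion fun σ : Equiv.Perm (Fin n) =>
    (finite_support_frobCoeff n σ.partition.parts).toFinset, fun σ τ => ?_⟩
  have hsub : (Function.support fun β =>
      frobCoeff n σ.partition.parts β * frobCoeff n τ.partition.parts β) ⊆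
      (univ.biUnion fun σ : Equiv.Perm (Fin n) =>
        (finite_support_frobCoeff n σ.partition.parts).toFinset : Finset (Fin n → ℤ)) := by
    intro β hβ
    simp only [coe_biUnion, Set.mem_iUnion, Set.Finite.coe_toFinset]
    exact ⟨σ, by simp, fun h => hβ (by simp [h])⟩
  rw [← finsum_eq_sum_of_support_subset _ hsub, finsum_frobCoeff_mul_frobCoeff
    (fun m hm => σ.partition.parts_pos hm) (fun m hm => τ.partition.parts_pos hm)
    (by rw [τ.partition.parts_sum, Fintype.card_fin])]
  refine if_congr ?_ rfl rfl
  rw [Equiv.Perm.partition_eq_of_isConj, Nat.Partition.ext_iff]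

theorem character_eq_of_isConj {σ τ : Equiv.Perm (Fin n)} (h : IsConj σ τ) :
    ρ.character σ = ρ.character τ := by
  obtain ⟨c, rfl⟩ := isConj_iff.1 h
  rw [Representation.char_mul_comm, inv_mul_cancel_left]

/-- Orthonormality involves `τ⁻¹`, which is conjugate to `τ` in a symmetric group, so no complex
conjugate is needed. -/
theorem sum_character_mul_character [FiniteDimensional ℂ V] (hρ : ρ.IsIrreducible) :
    ∑ τ, ρ.character τ * ρ.character τ = n.factorial := by
  classical
  have hne : (Nat.card (Equiv.Perm (Fin n)) : ℂ) ≠ 0 := Nat.cast_ne_zero.mpr Nat.card_pos.ne'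
  let : Invertible (Nat.card (Equiv.Perm (Fin n)) : ℂ) := invertibleOfNonzero hne
  have h := Representation.char_orthonormal ρ ρ
  rw [if_pos ⟨Representation.Equiv.refl ρ⟩, inv_mul_eq_iff_eq_mul₀ hne, mul_one, Nat.card_perm,
    Nat.card_fin] at h
  rw [← h]
  refine Finset.sum_congr rfl fun τ _ => ?_
  rw [character_eq_of_isConj ρ
    (Equiv.Perm.isConj_iff_cycleType_eq.2 (Equiv.Perm.cycleType_inv τ).symm)]

/-- Expansion of a character in the Frobenius characters. -/
theorem sum_sum_character_mul_frobCoeff_mul {S : Finset (Fin n → ℤ)}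
    (hS : ∀ σ τ : Equiv.Perm (Fin n),
      ∑ β ∈ S, frobCoeff n σ.partition.parts β * frobCoeff n τ.partition.parts β =
        if IsConj σ τ then (n.factorial * centralizerOrder σ.partition.parts : ℤ) else 0)
    (σ : Equiv.Perm (Fin n)) :
    ∑ β ∈ S, (∑ τ, ρ.character τ * (frobCoeff n τ.partition.parts β : ℂ)) *
      frobCoeff n σ.partition.parts β = n.factorial * n.factorial * ρ.character σ := by
  classical
  simp only [Finset.sum_mul]
  rw [Finset.sum_comm]
  -- Orthogonality over `β` leaves only the conjugacy class of `σ`, whose size times the centralizer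
  -- order is `n!`.
  have h1 : ∀ τ, ∑ β ∈ S, ρ.character τ * (frobCoeff n τ.partition.parts β : ℂ) *
      frobCoeff n σ.partition.parts β = if IsConj σ τ then
        ρ.character σ * (n.factorial * centralizerOrder σ.partition.parts) else 0 := by
    intro τ
    have h2 := congrArg (fun z : ℤ => ρ.character τ * (z : ℂ)) (hS σ τ)
    simp only [Int.cast_sum, Int.cast_mul, Finset.mul_sum] at h2
    calc _ = _ := Finset.sum_congr rfl fun β _ => by ring
      _ = _ := h2
      _ = _ := by
        split_ifs with h
        · rw [character_eq_of_isConj ρ h]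
          push_cast
          ring
        · simp
  simp only [h1]
  rw [← Finset.sum_filter, Finset.sum_const, nsmul_eq_mul]
  have h3 := card_isConj_mul_centralizerOrder σ
  rw [Nat.card_coe_set_eq, Set.ncard_eq_toFinset_card', Set.toFinset_ofPred] at h3
  have h4 : (#{τ | IsConj σ τ} : ℂ) * centralizerOrder σ.partition.parts = n.factorial := by
    exact_mod_cast h3.trans (congrArg Nat.factorial (Fintype.card_fin n))
  rw [← h4]
  ring

/-- An irreducible character of a symmetric group is bounded by the factorial of the number of
cycles. -/
theorem norm_character_le_factorial_numCycles [FiniteDimensional ℂ V] (hρ : ρ.IsIrreducible)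
    (σ : Equiv.Perm (Fin n)) : ‖ρ.character σ‖ ≤ (numCycles σ).factorial := by
  obtain ⟨S, hS⟩ := exists_finset_sum_frobCoeff_mul_frobCoeff n
  choose a ha using fun β : Fin n → ℤ => exists_sum_character_mul_frobCoeff ρ β
  have hn : (n.factorial : ℂ) ≠ 0 := Nat.cast_ne_zero.mpr n.factorial_ne_zero
  have hexp : ∀ τ, ∑ β ∈ S, (a β : ℂ) * frobCoeff n τ.partition.parts β =
      n.factorial * ρ.character τ := by
    intro τ
    have h := sum_sum_character_mul_frobCoeff_mul ρ hS τ
    simp only [ha, mul_assoc] at h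
    rw [← Finset.mul_sum] at h
    exact mul_left_cancel₀ hn h
  have hsq : ∑ β ∈ S, a β * a β = n.factorial := by
    have h : (n.factorial : ℂ) * ∑ β ∈ S, (a β * a β : ℂ) = n.factorial * n.factorial := by
      calc (n.factorial : ℂ) * ∑ β ∈ S, (a β * a β : ℂ)
          = ∑ β ∈ S, ∑ τ, ρ.character τ * (a β * frobCoeff n τ.partition.parts β) := by
            rw [Finset.mul_sum]
            refine Finset.sum_congr rfl fun β _ => ?_
            rw [mul_left_comm, ← ha, Finset.mul_sum]
            exact Finset.sum_congr rfl fun τ _ => mul_left_comm _ _ _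
        _ = ∑ τ, n.factorial * (ρ.character τ * ρ.character τ) := by
            rw [Finset.sum_comm]
            refine Finset.sum_congr rfl fun τ _ => ?_
            rw [← Finset.mul_sum, hexp, mul_left_comm]
        _ = n.factorial * n.factorial := by
            rw [← Finset.mul_sum, sum_character_mul_character ρ hρ]
    exact_mod_cast mul_left_cancel₀ hn h
  have hbound : ∀ β ∈ S, ‖(a β : ℂ) * frobCoeff n σ.partition.parts β‖ ≤
      (a β * a β : ℤ) * (numCycles σ).factorial := by
    intro β _
    -- Integrality of `a β` is what lets the sum of squares control the sum of absolute values.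
    have h1 : |a β| ≤ a β * a β := by
      rw [← abs_mul_abs_self]
      rcases eq_or_ne (a β) 0 with h | h
      · simp [h]
      · exact le_mul_of_one_le_left (abs_nonneg _) (Int.one_le_abs h)
    have h2 := abs_frobCoeff_le (fun m hm => σ.partition.parts_pos hm) β
    rw [card_parts_partition] at h2
    rw [norm_mul, Complex.norm_intCast, Complex.norm_intCast]
    exact_mod_cast mul_le_mul h1 h2 (abs_nonneg _) (mul_self_nonneg _)
  have h := (norm_sum_le _ _).trans (Finset.sum_le_sum hbound)
  rw [hexp, ← Finset.sum_mul, norm_mul, Complex.norm_natCast, ← Int.cast_sum, hsq,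
    Int.cast_natCast] at h
  exact le_of_mul_le_mul_left h (Nat.cast_pos.mpr n.factorial_pos)

end FrobeniusCoeff

theorem theorem7p2 (n : ℕ) (hn : 1 ≤ n) (k : ℕ) (σ : Equiv.Perm (Fin n)) (hk : numCycles σ = k)
    {V : Type*} [AddCommGroup V] [Module ℂ V] [FiniteDimensional ℂ V]
    (ρ : Representation ℂ (Equiv.Perm (Fin n)) V) (hρ : ρ.IsIrreducible) :
    ‖ρ.character σ‖ ≤ (2 : ℝ) ^ (k - 1) * (Nat.factorial k : ℝ) := by
  subst hk
  refine (FrobeniusCoeff.norm_character_le_factorial_numCycles ρ hρ σ).trans ?_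
  -- The factor `2 ^ (k - 1)` is at least one and is not otherwise needed.
  exact le_mul_of_one_le_left (by positivity) (one_le_pow₀ one_le_two)
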